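/- **Theorem 7.1.** Let $\mathcal C$ be a pointed model category with functorial factorizations. Write $*$ for the zero object and $[X,Y]$ for the set of morphisms from $X$ to $Y$ in the homotopy category of $\mathcal C$ (the localization of $\mathcal C$ at the weak equivalences); the trivial element of $[X,Y]$ is the class of the composite $X\to *\to Y$. The fibre of a map $p:X\to Y$ is the pullback of $p$ along $*\to Y$. An object $B$ is weakly contractible if $B\to *$ is a weak equivalence. For maps $f,g$ of $\mathcal C$, a morphism $f\to g$ is a commutative square, and $f$ and $g$ are weakly equivalent if they are joined by a finite zigzag of commutative squares $\cdot\to\cdot$ or $\cdot\leftarrow\cdot$ (through arbitrary maps of $\mathcal C$), each having a weak equivalence on sources and a weak equivalence on targets. A cofibration $i:A\to B$ has an *obstruction theory* if there are an object $W$ and, for every fibration $p:X\to Y$ with fibre $F$ and every commutative square $s:i\to p$, an element $\alpha_s\in[W,F]$ such that 1. there is a lift $B\to X$ in the square $s$ if and only if $\alpha_s$ is trivial; 2. for every morphism $\varphi:p\to p'$ between fibrations with fibres $F$ and $F'$, the element $\alpha_{\varphi\circ s}\in[W,F']$ is the composite of $\alpha_s$ with the induced map $F\to F'$. It has a *fibrant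 obstruction theory* if there are such data and properties where $p$ (and $p'$) range only over the fibrations with fibrant target. Consider the classes $\mathcal K$ of cofibrations with cofibrant source such that - $\mathcal K$ contains every cofibration with cofibrant source and weakly contractible target; - if $i'$ is a retract of some $i\in\mathcal K$, then $i'\in\mathcal K$; - if $i\in\mathcal K$ and $i'$ is a cofibration with cofibrant source that is weakly equivalent to $i$, then $i'\in\mathcal K$; - if $i':A'\to B'$ is a pushout of $i:A\to B$ in $\mathcal K$ along a map $A\to A'$ with $A'$ cofibrant, then $i'\in\mathcal K$. Then there is a smallest such class, and it is equal to the class of cofibrations with cofibrant source that have a fibrant obstruction theory. If $\mathcal C$ is right proper (base changes of weak equivalences along fibrations are weak equivalences), then it is also equal to the class of cofibrations with cofibrant source that have an obstruction theory. -/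

import Mathlib

open CategoryTheory Limits HomotopicalAlgebra

universe v u

namespace ModelObstruction

variable {C : Type u} [Category.{v} C] [ModelCategory C]

/-- An object `B` is weakly contractible if `B ⟶ ⊤_ C` is a weak equivalence; in a pointed
category the terminal object is the zero object. -/
def IsWeaklyContractible (B : C) : Prop :=
  WeakEquivalence (terminal.from B)

variable (C) in
/-- A model category is right proper if every base change of a weak equivalence along a
fibration is a weak equivalence: whenever `P = X ×_Y Y'` with `p : X ⟶ Y` a fibration and
`w : Y' ⟶ Y` a weak equivalence, the projection `P ⟶ X` is a weak equivalence. -/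
def IsRightProper : Prop :=
  ∀ ⦃P X Y' Y : C⦄ (w' : P ⟶ X) (p' : P ⟶ Y') (p : X ⟶ Y) (w : Y' ⟶ Y),
    IsPullback w' p' p w → Fibration p → WeakEquivalence w → WeakEquivalence w'

/-- A morphism of arrows (a commutative square) is a levelwise weak equivalence. -/
def IsLevelwiseWeakEquivalence {f g : Arrow C} (φ : f ⟶ g) : Prop :=
  WeakEquivalence φ.left ∧ WeakEquivalence φ.right

/-- Two morphisms of `C` are weakly equivalent if they are joined by a finite zigzag of levelwise
weak equivalences in the category of arrows (through arbitrary arrows). -/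
def WeaklyEquivalent (f g : Arrow C) : Prop :=
  Relation.EqvGen (fun a b : Arrow C ↦ ∃ φ : a ⟶ b, IsLevelwiseWeakEquivalence φ) f g

variable (C) in
/-- The class of cofibrations with cofibrant source. -/
def cofibrationsWithCofibrantSource : MorphismProperty C :=
  fun A _ i ↦ Cofibration i ∧ IsCofibrant A

variable (C) in
/-- The class of fibrations with fibrant target. -/
def fibrationsWithFibrantTarget : MorphismProperty C :=
  fun _ Y p ↦ Fibration p ∧ IsFibrant Y

/-- `K` is a class of cofibrations with cofibrant source that contains all cofibrations with
cofibrant source and weakly contractible target, and that is closed, among the cofibrations with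
cofibrant source, under retract, weak equivalence and cobase change. -/
structure IsAdmissibleClass (K : MorphismProperty C) : Prop where
  le : K ≤ cofibrationsWithCofibrantSource C
  contractible ⦃A B : C⦄ (i : A ⟶ B) : cofibrationsWithCofibrantSource C i →
    IsWeaklyContractible B → K i
  retract ⦃A B A' B' : C⦄ (i : A ⟶ B) (i' : A' ⟶ B') :
    Nonempty (RetractArrow i' i) → K i → K i'
  weakEquivalence ⦃A B A' B' : C⦄ (i : A ⟶ B) (i' : A' ⟶ B') :
    WeaklyEquivalent (Arrow.mk i) (Arrow.mk i') → cofibrationsWithCofibrantSource C i' →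
    K i → K i'
  cobaseChange ⦃A B A' B' : C⦄ (f : A ⟶ A') (i : A ⟶ B) (i' : A' ⟶ B') (g : B ⟶ B') :
    IsPushout f i i' g → IsCofibrant A' → K i → K i'

variable (C) in
/-- The localization functor from `C` to its homotopy category, in which the weak equivalences are
formally inverted. -/
abbrev toHo : C ⥤ (weakEquivalences C).Localization :=
  (weakEquivalences C).Q

/-- The set `[X, Y]` of weak homotopy classes from `X` to `Y`: the morphisms from `X` to `Y` in the
homotopy category of `C`. -/
abbrev WeakHomotopyClass (X Y : C) : Type (max u v) :=
  (toHo C).obj X ⟶ (toHo C).obj Y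

variable [HasZeroMorphisms C]

/-- The fibre of a morphism `p : X ⟶ Y`, that is, the pullback of `p` along `0 ⟶ Y`. -/
noncomputable abbrev fibre (p : Arrow C) : C :=
  kernel p.hom

/-- The map induced on fibres by a commutative square `p ⟶ p'`. -/
noncomputable abbrev fibreMap {p p' : Arrow C} (φ : p ⟶ p') : fibre p ⟶ fibre p' :=
  kernel.map p.hom p'.hom φ.left φ.right φ.w.symm

/-- The trivial weak homotopy class from `X` to `Y`. -/
def trivialClass (X Y : C) : WeakHomotopyClass X Y :=
  (toHo C).map (0 : X ⟶ Y)

/-- An obstruction theory for `i : A ⟶ B` with respect to the morphisms `p` in a class `P`: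
an object `W` and, for every commutative square from `i` to some `p` in `P`, a weak homotopy class
from `W` to the fibre of `p` which is trivial exactly when the square has a lift, and which is
functorial in `p`. -/
structure ObstructionTheory {A B : C} (i : A ⟶ B) (P : MorphismProperty C) where
  W : C
  obstruction ⦃p : Arrow C⦄ (hp : P p.hom) (s : Arrow.mk i ⟶ p) : WeakHomotopyClass W (fibre p)
  lift_iff ⦃p : Arrow C⦄ (hp : P p.hom) (s : Arrow.mk i ⟶ p) :
    (∃ l : B ⟶ p.left, i ≫ l = s.left ∧ l ≫ p.hom = s.right) ↔
      obstruction hp s = trivialClass W (fibre p)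
  functorial ⦃p p' : Arrow C⦄ (hp : P p.hom) (hp' : P p'.hom) (s : Arrow.mk i ⟶ p)
    (φ : p ⟶ p') :
    obstruction hp' (s ≫ φ) = obstruction hp s ≫ (toHo C).map (fibreMap φ)

/-- `i` has an obstruction theory with respect to all fibrations. -/
def HasObstructionTheory {A B : C} (i : A ⟶ B) : Prop :=
  Nonempty (ObstructionTheory i (fibrations C))

/-- `i` has a fibrant obstruction theory: the obstructions are only required for fibrations with
fibrant target. -/
def HasFibrantObstructionTheory {A B : C} (i : A ⟶ B) : Prop :=
  Nonempty (ObstructionTheory i (fibrationsWithFibrantTarget C))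

variable (C) in
/-- The class of cofibrations with cofibrant source that have a fibrant obstruction theory. -/
def fibrantObstructionClass : MorphismProperty C :=
  fun _ _ i ↦ cofibrationsWithCofibrantSource C i ∧ HasFibrantObstructionTheory i

variable (C) in
/-- The class of cofibrations with cofibrant source that have an obstruction theory. -/
def obstructionClass : MorphismProperty C :=
  fun _ _ i ↦ cofibrationsWithCofibrantSource C i ∧ HasObstructionTheory i

end ModelObstruction

/-!
The class of cofibrations with cofibrant source that have a fibrant obstruction theory is the
smallest admissible class.

*It is admissible.* Closure under retracts and cobase changes is formal. If `i : A ⟶ B` has a weakly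
contractible fibrant target, then a square from `i` to a fibration `p` with fibre `F` amounts to a
map from `A` to the base change `E` of `p` to `B`, a lift exists if and only if this map is trivial
in the homotopy category, and `F ⟶ E` is a weak equivalence
(`weakEquivalence_of_isLimit_kernelFork`); so the obstruction lives in `[A, F]`. For the closure
under weak equivalence, cofibrant replacement of arrows reduces a zigzag to levelwise weak
equivalences between cofibrations with cofibrant source, and these factor as a projective trivial
cofibration followed by a retraction. Along a projective trivial cofibration `i ⟶ i'`, a theory for
`i` restricts to one for `i'`; conversely a square from `i` to a fibration with fibrant target
extends to `i'`, and the obstruction does not depend on the extension because any two extensions are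
homotopic (`ObstructionTheory.obstruction_eq`).

*It is minimal.* Given `i` with a fibrant obstruction theory, replace it by a fibration `p : X ⟶ Y`
with fibrant target. The obstruction of the canonical square is represented by a map `W ⟶ F`.
Attaching a cone along `W ⟶ F ⟶ X` gives a map `X ⟶ D` in every admissible class, and it kills the
obstruction, so that `B` lifts to `D` and `i` is a retract of `X ⟶ D` up to weak equivalence
(`IsAdmissibleClass.of_hasFibrantObstructionTheory`).

*Right properness* makes the map from a fibration to its functorial fibrant replacement a weak
equivalence on fibres, and a lift against the replacement yields a lift against the fibration; hence
a fibrant obstruction theory extends to all fibrations.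
-/

namespace ModelObstruction

variable {C : Type u} [Category.{v} C] [ModelCategory C]

attribute [local simp] prod.lift_fst prod.lift_snd prod.lift_fst_assoc prod.lift_snd_assoc
  prod.map_fst prod.map_snd prod.map_fst_assoc prod.map_snd_assoc
  pullback.lift_fst pullback.lift_snd pullback.lift_fst_assoc pullback.lift_snd_assoc
  pushout.inl_desc pushout.inr_desc pushout.inl_desc_assoc pushout.inr_desc_assoc

/-! ### Factorizations and lifts along weak equivalences over a base -/

lemma exists_trivialCofibration_fibration {X Y : C} (f : X ⟶ Y) :
    ∃ (Z : C) (i : X ⟶ Z) (p : Z ⟶ Y),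
      Cofibration i ∧ WeakEquivalence i ∧ Fibration p ∧ i ≫ p = f := by
  let d := MorphismProperty.factorizationData (trivialCofibrations C) (fibrations C) f
  exact ⟨d.Z, d.i, d.p, inferInstance, inferInstance, inferInstance, d.fac⟩

lemma exists_cofibration_trivialFibration {X Y : C} (f : X ⟶ Y) :
    ∃ (Z : C) (i : X ⟶ Z) (p : Z ⟶ Y),
      Cofibration i ∧ Fibration p ∧ WeakEquivalence p ∧ i ≫ p = f := by
  let d := MorphismProperty.factorizationData (cofibrations C) (trivialFibrations C) f
  exact ⟨d.Z, d.i, d.p, inferInstance, inferInstance, inferInstance, d.fac⟩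

/-- A lift against `p'` can be transported back along a weak equivalence `w` over the common
target to a lift against `p`, provided that `p` is a fibration. No assumption on `p'` is needed. -/
lemma exists_lift_of_weakEquivalence {A B X X' Y : C} (i : A ⟶ B) [Cofibration i]
    (p : X ⟶ Y) [Fibration p] (p' : X' ⟶ Y) (w : X ⟶ X') [WeakEquivalence w]
    (hw : w ≫ p' = p) (f : A ⟶ X) (l' : B ⟶ X') (hl' : i ≫ l' = f ≫ w) :
    ∃ l : B ⟶ X, i ≫ l = f ∧ l ≫ p = l' ≫ p' := by
  obtain ⟨Z, j, q, _, _, _, fac⟩ := exists_trivialCofibration_fibration w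
  have := weakEquivalence_of_precomp_of_fac fac
  have sq : CommSq (f ≫ j) i q l' := ⟨by rw [Category.assoc, fac, hl']⟩
  -- `X` is a retract of `Z` over `Y`, since `j` is a trivial cofibration and `p` a fibration
  have sq' : CommSq (𝟙 X) j p (q ≫ p') := ⟨by rw [reassoc_of% fac, hw, Category.id_comp]⟩
  exact ⟨sq.lift ≫ sq'.lift, by simp, by simp⟩

/-- Extension of a map along a cofibration into a fibrant object only depends on the map up to
homotopy: if `g` extends along `i` and `f`, `g` agree in the homotopy category, then `f` extends. -/
lemma exists_extension_of_toHo_map_eq {A B X : C} (i : A ⟶ B) [Cofibration i]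
    [IsCofibrant A] [IsFibrant X] (f g : A ⟶ X) (hfg : (toHo C).map f = (toHo C).map g)
    (l : B ⟶ X) (hl : i ≫ l = g) : ∃ l' : B ⟶ X, i ≫ l' = f := by
  obtain ⟨P, _, ⟨h⟩⟩ :=
    ((RightHomotopyRel.iff_map_eq (toHo C) A X).2 hfg.symm).exists_good_pathObject
  obtain ⟨l', h', hh'⟩ := h.homotopy_extension i l hl
  refine ⟨l', ?_⟩
  rw [← h'.h₁, reassoc_of% hh', h.h₁]

instance isIso_toHo_map {X Y : C} (w : X ⟶ Y) [WeakEquivalence w] : IsIso ((toHo C).map w) :=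
  Localization.inverts _ (weakEquivalences C) w (mem_weakEquivalences w)

/-- In the homotopy category, all maps to a weakly contractible object agree. -/
lemma toHo_map_eq_of_isWeaklyContractible {A B : C} (hB : IsWeaklyContractible B)
    (f g : A ⟶ B) : (toHo C).map f = (toHo C).map g := by
  have : WeakEquivalence (terminal.from B) := hB
  rw [← cancel_mono ((toHo C).map (terminal.from B)), ← Functor.map_comp, ← Functor.map_comp,
    Subsingleton.elim (f ≫ _) (g ≫ _)]

lemma weakEquivalence_of_isPullback {P X Y Z : C} {fst : P ⟶ X} {snd : P ⟶ Y} {f : X ⟶ Z}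
    {g : Y ⟶ Z} (h : IsPullback fst snd f g) [Fibration g] [WeakEquivalence g] :
    WeakEquivalence fst :=
  ((mem_trivialFibrations_iff _).1
    (MorphismProperty.of_isPullback h.flip (mem_trivialFibrations g))).2

lemma fibration_of_isPullback {P X Y Z : C} {fst : P ⟶ X} {snd : P ⟶ Y} {f : X ⟶ Z}
    {g : Y ⟶ Z} (h : IsPullback fst snd f g) [Fibration g] : Fibration fst :=
  (fibration_iff _).2 (MorphismProperty.of_isPullback h.flip (mem_fibrations g))

lemma weakEquivalence_prod_fst (X B : C) [IsFibrant B] (hB : IsWeaklyContractible B) :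
    WeakEquivalence (prod.fst : X ⨯ B ⟶ X) := by
  have : Fibration (terminalIsTerminal.from B) := inferInstanceAs (Fibration (terminal.from B))
  have : WeakEquivalence (terminalIsTerminal.from B) := hB
  exact weakEquivalence_of_isPullback (Y := B) (g := terminalIsTerminal.from B)
    (IsPullback.of_isLimit_binaryFan_of_isTerminal
    (limit.isLimit (pair X B)) terminalIsTerminal)

lemma weakEquivalence_prod_snd (B X : C) [IsFibrant B] (hB : IsWeaklyContractible B) :
    WeakEquivalence (prod.snd : B ⨯ X ⟶ X) := by
  have : Fibration (terminalIsTerminal.from B) := inferInstanceAs (Fibration (terminal.from B))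
  have : WeakEquivalence (terminalIsTerminal.from B) := hB
  exact weakEquivalence_of_isPullback (Y := B) (g := terminalIsTerminal.from B)
    (IsPullback.of_isLimit_binaryFan_of_isTerminal
    (limit.isLimit (pair B X)) terminalIsTerminal).flip

/-- If the base of a fibration between fibrant objects is weakly contractible, then a lift
exists as soon as the map to the total space extends, regardless of the map to the base. -/
lemma exists_lift_of_exists_extension {A B X Y : C} (i : A ⟶ B) [Cofibration i]
    [IsFibrant Y] (hY : IsWeaklyContractible Y) (q : X ⟶ Y) [Fibration q]
    (f : A ⟶ X) (b : B ⟶ Y) (w : f ≫ q = i ≫ b) (h : B ⟶ X) (hh : i ≫ h = f) :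
    ∃ l : B ⟶ X, i ≫ l = f ∧ l ≫ q = b := by
  have := weakEquivalence_prod_fst X Y hY
  -- the graph of `q` is a weak equivalence over `Y`
  have : WeakEquivalence (prod.lift (𝟙 X) q) :=
    weakEquivalence_of_postcomp_of_fac (prod.lift_fst (𝟙 X) q)
  obtain ⟨l, h₁, h₂⟩ := exists_lift_of_weakEquivalence i q prod.snd (prod.lift (𝟙 X) q)
    (by simp) f (prod.lift h b) (by ext <;> simp [hh, w])
  exact ⟨l, h₁, by simpa using h₂⟩

/-! ### Projective trivial cofibrations of arrows -/

/-- The map `B ⊔_A A' ⟶ B'` induced by a square `φ` from `A ⟶ B` to `A' ⟶ B'`. -/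
noncomputable def cornerMap {f g : Arrow C} (φ : f ⟶ g) : pushout f.hom φ.left ⟶ g.right :=
  pushout.desc φ.right g.hom φ.w.symm

lemma inl_cornerMap {f g : Arrow C} (φ : f ⟶ g) : pushout.inl _ _ ≫ cornerMap φ = φ.right :=
  pushout.inl_desc _ _ _

lemma inr_cornerMap {f g : Arrow C} (φ : f ⟶ g) : pushout.inr _ _ ≫ cornerMap φ = g.hom :=
  pushout.inr_desc _ _ _

lemma inl_cornerMap_assoc {f g : Arrow C} (φ : f ⟶ g) {Z : C} (h : g.right ⟶ Z) :
    pushout.inl _ _ ≫ cornerMap φ ≫ h = φ.right ≫ h := by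
  rw [← Category.assoc, inl_cornerMap]

lemma inr_cornerMap_assoc {f g : Arrow C} (φ : f ⟶ g) {Z : C} (h : g.right ⟶ Z) :
    pushout.inr _ _ ≫ cornerMap φ ≫ h = g.hom ≫ h := by
  rw [← Category.assoc, inr_cornerMap]

/-- The trivial cofibrations of the projective model structure on arrows: the map on sources and
the corner map are trivial cofibrations. -/
structure IsProjectiveTrivialCofibration {f g : Arrow C} (φ : f ⟶ g) : Prop where
  cofibration_left : Cofibration φ.left
  weakEquivalence_left : WeakEquivalence φ.left
  cofibration_corner : Cofibration (cornerMap φ)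
  weakEquivalence_corner : WeakEquivalence (cornerMap φ)

lemma IsProjectiveTrivialCofibration.exists_lift {f g x y : Arrow C} {φ : f ⟶ g}
    (hφ : IsProjectiveTrivialCofibration φ) (ψ : x ⟶ y) [Fibration ψ.left] [Fibration ψ.right]
    (s : f ⟶ x) (t : g ⟶ y) (w : s ≫ ψ = φ ≫ t) : ∃ l : g ⟶ x, φ ≫ l = s ∧ l ≫ ψ = t := by
  obtain ⟨_, _, _, _⟩ := hφ
  have w₁ : s.left ≫ ψ.left = φ.left ≫ t.left := congr_arg CommaMorphism.left w
  have w₂ : s.right ≫ ψ.right = φ.right ≫ t.right := congr_arg CommaMorphism.right w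
  have sq₁ : CommSq s.left φ.left ψ.left t.left := ⟨w₁⟩
  have sq₂ : CommSq (pushout.desc s.right (sq₁.lift ≫ x.hom) (by simp)) (cornerMap φ)
      ψ.right t.right := by
    refine ⟨?_⟩
    apply pushout.hom_ext
    · simp [w₂, inl_cornerMap_assoc]
    · have := sq₁.fac_right
      rw [pushout.inr_desc_assoc, inr_cornerMap_assoc, Category.assoc, ← Arrow.w,
        reassoc_of% this, Arrow.w]
  refine ⟨Arrow.homMk sq₁.lift sq₂.lift ?_, ?_, ?_⟩
  · rw [← inr_cornerMap φ, Category.assoc, sq₂.fac_left, pushout.inr_desc]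
  · ext
    · simp
    · change φ.right ≫ sq₂.lift = _
      rw [← inl_cornerMap φ, Category.assoc, sq₂.fac_left, pushout.inl_desc]
  · ext <;> simp

/-- A levelwise weak equivalence between cofibrations with cofibrant source factors as a projective
trivial cofibration `φ₁` followed by a map `φ₂` with a section `σ`. Here `φ₂` is a levelwise trivial
fibration, and it has a section because its target is projectively cofibrant. -/
lemma exists_isProjectiveTrivialCofibration {A B A' B' : C} {i : A ⟶ B} {i' : A' ⟶ B'}
    (φ : Arrow.mk i ⟶ Arrow.mk i') (hφ : IsLevelwiseWeakEquivalence φ)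
    (hi : cofibrationsWithCofibrantSource C i) (hi' : cofibrationsWithCofibrantSource C i') :
    ∃ (A'' B'' : C) (j : A'' ⟶ B'') (φ₁ : Arrow.mk i ⟶ Arrow.mk j)
      (φ₂ : Arrow.mk j ⟶ Arrow.mk i') (σ : Arrow.mk i' ⟶ Arrow.mk j),
      IsProjectiveTrivialCofibration φ₁ ∧ σ ≫ φ₂ = 𝟙 _ ∧ cofibrationsWithCofibrantSource C j ∧
        IsLevelwiseWeakEquivalence σ := by
  obtain ⟨_, _⟩ := hφ
  obtain ⟨_, _⟩ := hi
  obtain ⟨_, _⟩ := hi'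
  obtain ⟨A'', a, q, _, _, _, haq⟩ := exists_trivialCofibration_fibration φ.left
  have hw : φ.left ≫ i' = i ≫ φ.right := φ.w
  obtain ⟨B'', b, r, _, _, _, hbr⟩ := exists_cofibration_trivialFibration
    (pushout.desc φ.right (q ≫ i') (by rw [reassoc_of% haq, hw]) : pushout i a ⟶ B')
  have : WeakEquivalence q := weakEquivalence_of_precomp_of_fac haq
  have : WeakEquivalence (pushout.inl i a ≫ b) := by
    have : (pushout.inl i a ≫ b) ≫ r = φ.right := by simp [hbr]
    exact weakEquivalence_of_postcomp_of_fac this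
  have : WeakEquivalence b := weakEquivalence_of_precomp (pushout.inl i a) b
  let j : A'' ⟶ B'' := pushout.inr i a ≫ b
  have hj : j ≫ r = q ≫ i' := by simp [j, hbr]
  have sq₁ : CommSq (initial.to A'') (initial.to A') q (𝟙 A') := ⟨Subsingleton.elim _ _⟩
  have sq₂ : CommSq (sq₁.lift ≫ j) i' r (𝟙 B') := ⟨by simp [hj]⟩
  let φ₁ : Arrow.mk i ⟶ Arrow.mk j := Arrow.homMk a (pushout.inl i a ≫ b)
    (by simp [j, ← pushout.condition_assoc])
  have hb : cornerMap φ₁ = b := by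
    apply pushout.hom_ext
    · exact inl_cornerMap φ₁
    · exact inr_cornerMap φ₁
  have : WeakEquivalence sq₁.lift := weakEquivalence_of_postcomp_of_fac sq₁.fac_right
  have : WeakEquivalence sq₂.lift := weakEquivalence_of_postcomp_of_fac sq₂.fac_right
  refine ⟨A'', B'', j, φ₁, Arrow.homMk q r (by simp [hj]),
    Arrow.homMk sq₁.lift sq₂.lift (by simp), ⟨‹_›, ‹_›, ?_, ?_⟩, ?_, ⟨?_, ?_⟩, ⟨?_, ?_⟩⟩
  · rwa [hb]
  · rwa [hb]
  · ext <;> simp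
  · infer_instance
  · exact isCofibrant_of_cofibration (X := A) a
  · simpa
  · simpa

lemma IsProjectiveTrivialCofibration.exists_extension {f g : Arrow C} {φ : f ⟶ g}
    (hφ : IsProjectiveTrivialCofibration φ) {p : Arrow C}
    (hp : fibrationsWithFibrantTarget C p.hom) (s : f ⟶ p) : ∃ t : g ⟶ p, φ ≫ t = s := by
  obtain ⟨_, _⟩ := hp
  have : IsFibrant p.left := isFibrant_of_fibration p.hom
  let ψ : p ⟶ Arrow.mk (𝟙 (⊤_ C)) :=
    Arrow.homMk (terminal.from _) (terminal.from _) (terminalIsTerminal.hom_ext _ _)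
  have : Fibration ψ.left := inferInstanceAs (Fibration (terminal.from p.left))
  have : Fibration ψ.right := inferInstanceAs (Fibration (terminal.from p.right))
  obtain ⟨t, ht, -⟩ := hφ.exists_lift ψ s
    (Arrow.homMk (terminal.from _) (terminal.from _) (terminalIsTerminal.hom_ext _ _))
    (Arrow.hom_ext _ _ (terminalIsTerminal.hom_ext _ _) (terminalIsTerminal.hom_ext _ _))
  exact ⟨t, ht⟩

/-! ### Functorial replacement of arrows -/

variable (C) in
/-- Cofibrant replacement of arrows in the projective model structure. The functorial
factorization makes it compatible with levelwise weak equivalences between arbitrary arrows. -/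
lemma exists_cofibrantReplacement_arrow
    [MorphismProperty.HasFunctorialFactorization (cofibrations C) (trivialFibrations C)] :
    ∃ R : Arrow C → Arrow C, (∀ f, cofibrationsWithCofibrantSource C (R f).hom) ∧
      (∀ f, ∃ ε : R f ⟶ f, IsLevelwiseWeakEquivalence ε) ∧
      ∀ ⦃f g : Arrow C⦄ (φ : f ⟶ g), IsLevelwiseWeakEquivalence φ →
        ∃ ψ : R f ⟶ R g, IsLevelwiseWeakEquivalence ψ := by
  let d := MorphismProperty.functorialFactorizationData (cofibrations C) (trivialFibrations C)
  let Q (X : C) := d.factorizationData (initial.to X)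
  let R (f : Arrow C) := d.factorizationData ((Q f.left).p ≫ f.hom)
  refine ⟨fun f ↦ Arrow.mk (R f).i, fun f ↦ ⟨inferInstanceAs (Cofibration (R f).i), ?_⟩,
    fun f ↦ ⟨Arrow.homMk (Q f.left).p (R f).p (R f).fac.symm,
      inferInstanceAs (WeakEquivalence (Q f.left).p), inferInstanceAs (WeakEquivalence (R f).p)⟩,
    fun f g φ ⟨h₁, h₂⟩ ↦ ?_⟩
  · exact (isCofibrant_iff_of_isInitial (Q f.left).i initialIsInitial).2 inferInstance
  · let u : (Q f.left).Z ⟶ (Q g.left).Z :=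
      d.mapZ (Arrow.homMk (𝟙 _) φ.left (initialIsInitial.hom_ext _ _))
    have hu : u ≫ (Q g.left).p = (Q f.left).p ≫ φ.left := d.mapZ_p _
    let τ : Arrow.mk ((Q f.left).p ≫ f.hom) ⟶ Arrow.mk ((Q g.left).p ≫ g.hom) :=
      Arrow.homMk u φ.right (by simp [reassoc_of% hu])
    have hv : d.mapZ τ ≫ (R g).p = (R f).p ≫ φ.right := d.mapZ_p τ
    refine ⟨Arrow.homMk u (d.mapZ τ) (d.i_mapZ τ).symm, ?_, ?_⟩
    · exact weakEquivalence_of_postcomp_of_fac hu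
    · exact weakEquivalence_of_postcomp_of_fac hv

variable (C) in
/-- Functorial replacement of arrows by fibrations with fibrant target. -/
lemma exists_fibrantReplacement_arrow
    [MorphismProperty.HasFunctorialFactorization (trivialCofibrations C) (fibrations C)] :
    ∃ (R : Arrow C → Arrow C) (η : ∀ p, p ⟶ R p),
      (∀ p, fibrationsWithFibrantTarget C (R p).hom) ∧
      (∀ p, IsLevelwiseWeakEquivalence (η p)) ∧
      ∀ ⦃p p' : Arrow C⦄ (φ : p ⟶ p'), ∃ ψ : R p ⟶ R p', η p ≫ ψ = φ ≫ η p' := by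
  let d := MorphismProperty.functorialFactorizationData (trivialCofibrations C) (fibrations C)
  let Y (p : Arrow C) := d.factorizationData (terminal.from p.right)
  let X (p : Arrow C) := d.factorizationData (p.hom ≫ (Y p).i)
  refine ⟨fun p ↦ Arrow.mk (X p).p, fun p ↦ Arrow.homMk (X p).i (Y p).i (X p).fac,
    fun p ↦ ⟨inferInstanceAs (Fibration (X p).p), ?_⟩,
    fun p ↦ ⟨inferInstanceAs (WeakEquivalence (X p).i), inferInstanceAs (WeakEquivalence (Y p).i)⟩,
    fun p p' φ ↦ ?_⟩
  · exact (isFibrant_iff_of_isTerminal (Y p).p terminalIsTerminal).2 inferInstance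
  · let v : (Y p).Z ⟶ (Y p').Z :=
      d.mapZ (Arrow.homMk φ.right (𝟙 _) (terminalIsTerminal.hom_ext _ _))
    have hv : (Y p).i ≫ v = φ.right ≫ (Y p').i := d.i_mapZ _
    let τ : Arrow.mk (p.hom ≫ (Y p).i) ⟶ Arrow.mk (p'.hom ≫ (Y p').i) :=
      Arrow.homMk φ.left v (by simp [hv])
    exact ⟨Arrow.homMk (d.mapZ τ) v (d.mapZ_p τ), Arrow.hom_ext _ _ (d.i_mapZ τ) hv⟩

/-! ### Right properness -/

lemma IsRightProper.weakEquivalence_pullback_lift (hC : IsRightProper C) {X Y X' Y' : C}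
    (f : X ⟶ X') (p : X ⟶ Y) (p' : X' ⟶ Y') (g : Y ⟶ Y') [Fibration p'] [WeakEquivalence f]
    [WeakEquivalence g] (w : f ≫ p' = p ≫ g) : WeakEquivalence (pullback.lift f p w) := by
  have : WeakEquivalence (pullback.fst p' g) :=
    hC _ _ _ _ (IsPullback.of_hasPullback p' g) inferInstance inferInstance
  exact weakEquivalence_of_postcomp_of_fac (pullback.lift_fst f p w)

/-- In a right proper model category, a square from a cofibration to a fibration `p` has a lift as
soon as its composite with a levelwise weak equivalence from `p` to another fibration does. -/
lemma IsRightProper.exists_lift (hC : IsRightProper C) {A B : C} {i : A ⟶ B} [Cofibration i]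
    {p p' : Arrow C} [Fibration p.hom] [Fibration p'.hom] (φ : p ⟶ p')
    (hφ : IsLevelwiseWeakEquivalence φ) (s : Arrow.mk i ⟶ p) (l : B ⟶ p'.left)
    (h₁ : i ≫ l = s.left ≫ φ.left) (h₂ : l ≫ p'.hom = s.right ≫ φ.right) :
    ∃ l : B ⟶ p.left, i ≫ l = s.left ∧ l ≫ p.hom = s.right := by
  obtain ⟨_, _⟩ := hφ
  have := hC.weakEquivalence_pullback_lift φ.left p.hom p'.hom φ.right φ.w
  have hs : s.left ≫ p.hom = i ≫ s.right := s.w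
  obtain ⟨l', h₃, h₄⟩ := exists_lift_of_weakEquivalence i p.hom (pullback.snd _ _)
    (pullback.lift φ.left p.hom φ.w) (pullback.lift_snd _ _ _) s.left
    (pullback.lift l s.right h₂) (by
      apply pullback.hom_ext
      · rw [Category.assoc, Category.assoc, pullback.lift_fst, pullback.lift_fst, h₁]
      · rw [Category.assoc, Category.assoc, pullback.lift_snd, pullback.lift_snd, hs])
  exact ⟨l', h₃, h₄.trans (pullback.lift_snd _ _ _)⟩

/-! ### Base change of fibrations along squares -/

/-- The map from the source of `i` to the total space of the base change of `p` induced by a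
square from `i` to `p`. -/
noncomputable def sourceToPullback {A B : C} {i : A ⟶ B} {p : Arrow C} (s : Arrow.mk i ⟶ p) :
    A ⟶ pullback (C := C) (X := B) s.right p.hom :=
  pullback.lift i s.left s.w.symm

/-- The map between base changes of `p` and `p'` induced by `ψ : p ⟶ p'`. -/
noncomputable def pullbackMap {B : C} {p p' : Arrow C} (b : B ⟶ p.right) (b' : B ⟶ p'.right)
    (ψ : p ⟶ p') (h : b ≫ ψ.right = b') : pullback b p.hom ⟶ pullback b' p'.hom :=
  pullback.lift (pullback.fst _ _) (pullback.snd _ _ ≫ ψ.left) (by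
    rw [← h, pullback.condition_assoc, Category.assoc, Arrow.w])

lemma sourceToPullback_pullbackMap {A B : C} {i : A ⟶ B} {p p' : Arrow C} (s : Arrow.mk i ⟶ p)
    (ψ : p ⟶ p') :
    sourceToPullback s ≫ pullbackMap (B := B) s.right (s ≫ ψ).right ψ rfl =
      sourceToPullback (s ≫ ψ) := by
  apply pullback.hom_ext
  · simp only [sourceToPullback, pullbackMap, Category.assoc, pullback.lift_fst]
  · simp only [sourceToPullback, pullbackMap, Category.assoc, pullback.lift_snd,
      pullback.lift_snd_assoc]
    rfl

/-! ### Retracts up to weak equivalence in an admissible class -/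

lemma IsAdmissibleClass.of_hom {K : MorphismProperty C} (hK : IsAdmissibleClass K)
    {A B A' B' : C} {i : A ⟶ B} {i' : A' ⟶ B'} (a : A ⟶ A') (b : B ⟶ B') [WeakEquivalence a]
    [WeakEquivalence b] (w : a ≫ i' = i ≫ b) (hi' : cofibrationsWithCofibrantSource C i')
    (h : K i) : K i' :=
  hK.weakEquivalence i i' (.rel _ _ ⟨Arrow.homMk a b w, ‹_›, ‹_›⟩) hi' h

lemma IsAdmissibleClass.of_hom' {K : MorphismProperty C} (hK : IsAdmissibleClass K)
    {A B A' B' : C} {i : A ⟶ B} {i' : A' ⟶ B'} (a : A ⟶ A') (b : B ⟶ B') [WeakEquivalence a]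
    [WeakEquivalence b] (w : a ≫ i' = i ≫ b) (hi : cofibrationsWithCofibrantSource C i)
    (h : K i') : K i :=
  hK.weakEquivalence i' i (.symm _ _ (.rel _ _ ⟨Arrow.homMk a b w, ‹_›, ‹_›⟩)) hi h

/-- An admissible class is closed under retracts up to weak equivalence: it contains `i` if it
contains `j` and there are squares `(u, l) : i ⟶ j` and `(𝟙 X, q) : j ⟶ p` whose composite is a
levelwise weak equivalence, with `u` a cofibration. -/
lemma IsAdmissibleClass.of_weak_retract {K : MorphismProperty C} (hK : IsAdmissibleClass K)
    {A B X D Y : C} {i : A ⟶ B} (hi : cofibrationsWithCofibrantSource C i) {j : X ⟶ D} (hj : K j)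
    (u : A ⟶ X) [Cofibration u] [WeakEquivalence u] (l : B ⟶ D) (q : D ⟶ Y)
    (w : i ≫ l = u ≫ j) [WeakEquivalence (l ≫ q)] : K i := by
  have := hi.1
  have := (hK.le _ hj).1
  have := (hK.le _ hj).2
  obtain ⟨B₂, e, r, _, _, _, her⟩ := exists_cofibration_trivialFibration
    (pushout.desc (l ≫ q) (j ≫ q) (by rw [reassoc_of% w]) : pushout i u ⟶ Y)
  obtain ⟨D₁, m, t, _, _, _, hmt⟩ := exists_cofibration_trivialFibration
    (pushout.desc l j w : pushout i u ⟶ D)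
  -- `X ⟶ B₂` is weakly equivalent to `i`, and `X ⟶ D₁` to `j`; it remains to see that
  -- `X ⟶ B₂` is a retract of a map weakly equivalent to `X ⟶ D₁`
  have hl : (pushout.inl i u ≫ e) ≫ r = l ≫ q := by simp [her]
  have : WeakEquivalence (pushout.inl i u ≫ e) := weakEquivalence_of_postcomp_of_fac hl
  have : WeakEquivalence e := weakEquivalence_of_precomp (pushout.inl i u) e
  have sq : CommSq e m r (t ≫ q) := by
    refine ⟨?_⟩
    rw [her, reassoc_of% hmt]
    apply pushout.hom_ext <;> simp
  let k : X ⟶ D₁ := pushout.inr i u ≫ m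
  have hk : K k := by
    refine hK.of_hom' (𝟙 X) t ?_ ⟨inferInstance, inferInstance⟩ hj
    simp [k, hmt]
  -- the lift `D₁ ⟶ B₂` extends `e`, so pushing out along the trivial cofibration `e` makes it split
  let k' : X ⟶ pushout m e := k ≫ pushout.inl m e
  have hk' : K k' :=
    hK.of_hom (𝟙 X) (pushout.inl m e) (by simp [k']) ⟨inferInstance, inferInstance⟩ hk
  have hr : RetractArrow (pushout.inr i u ≫ e) k' :=
    { i := Arrow.homMk (𝟙 X) (pushout.inr m e) (by simp [k', k, pushout.condition])
      r := Arrow.homMk (𝟙 X) (pushout.desc sq.lift (𝟙 B₂) (by simp)) (by simp [k', k])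
      retract := by
        apply Arrow.hom_ext
        · exact Category.comp_id _
        · exact pushout.inr_desc _ _ _ }
  refine hK.of_hom' u (pushout.inl i u ≫ e) ?_ hi (hK.retract _ _ ⟨hr⟩ hk')
  rw [pushout.condition_assoc]

variable [HasZeroMorphisms C]

/-! ### Weak equivalences between fibres -/

/-- The fibre of `q ≫ p` maps to the fibre of `p` by a base change of `q`. -/
lemma isPullback_kernel_comp {Z X Y : C} (q : Z ⟶ X) (p : X ⟶ Y) (k : kernel (q ≫ p) ⟶ kernel p)
    (hk : k ≫ kernel.ι p = kernel.ι (q ≫ p) ≫ q) :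
    IsPullback k (kernel.ι (q ≫ p)) (kernel.ι p) q := by
  refine ⟨⟨hk⟩, ⟨PullbackCone.IsLimit.mk _ (fun s ↦ kernel.lift _ s.snd ?_) ?_ ?_ ?_⟩⟩
  · rw [← s.condition_assoc]; simp
  · intro s
    rw [← cancel_mono (kernel.ι p)]
    simp [hk, s.condition]
  · intro s; simp
  · intro s m _ h
    rw [← cancel_mono (kernel.ι (q ≫ p))]
    simpa using h

/-- A weak equivalence between fibrations over the same base is a weak equivalence on fibres. -/
lemma weakEquivalence_kernel_of_fac {X X' Y : C} (p : X ⟶ Y) (p' : X' ⟶ Y) [Fibration p]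
    [Fibration p'] (w : X ⟶ X') [WeakEquivalence w] (fac : w ≫ p' = p)
    (k : kernel p ⟶ kernel p') (hk : k ≫ kernel.ι p' = kernel.ι p ≫ w) :
    WeakEquivalence k := by
  obtain ⟨Z, j, r, _, _, _, hr⟩ :=
    exists_trivialCofibration_fibration (pullback.lift (𝟙 X) w (by simp [fac]) :
      X ⟶ pullback p p')
  -- `w` is the composite of a section of the trivial fibration `q` with the trivial fibration `q'`
  let q : Z ⟶ X := r ≫ pullback.fst p p'
  let q' : Z ⟶ X' := r ≫ pullback.snd p p'
  have hq : j ≫ q = 𝟙 X := by simp [q, reassoc_of% hr]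
  have hq' : j ≫ q' = w := by simp [q', reassoc_of% hr]
  have e : q ≫ p = q' ≫ p' := by simp [q, q', pullback.condition]
  have := weakEquivalence_of_precomp_of_fac hq
  have := weakEquivalence_of_precomp_of_fac hq'
  let k₁ : kernel (q ≫ p) ⟶ kernel p := kernel.lift _ (kernel.ι _ ≫ q) (by simp)
  let k₂ : kernel (q' ≫ p') ⟶ kernel p' := kernel.lift _ (kernel.ι _ ≫ q') (by simp)
  have := weakEquivalence_of_isPullback (isPullback_kernel_comp q p k₁ (by simp [k₁]))
  have := weakEquivalence_of_isPullback (isPullback_kernel_comp q' p' k₂ (by simp [k₂]))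
  let s : kernel p ⟶ kernel (q ≫ p) :=
    kernel.lift _ (kernel.ι _ ≫ j) (by simp [reassoc_of% hq])
  have hs : s ≫ k₁ = 𝟙 _ := by
    rw [← cancel_mono (kernel.ι p)]
    simp [s, k₁, hq]
  have : WeakEquivalence s := weakEquivalence_of_postcomp_of_fac hs
  have : k = s ≫ (kernelIsoOfEq e).hom ≫ k₂ := by
    rw [← cancel_mono (kernel.ι p')]
    simp [s, k₂, hk, hq']
  rw [this]
  infer_instance

/-- The fibre inclusion of a fibration `q` over a fibrant weakly contractible object is a weak
equivalence. The space `E'` of paths in `E` that start in the fibre `F` maps to both `F` and `E` by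
trivial fibrations, because its map to `E` is a base change of the fibration
`Q ⟶ Y ⨯ E` from the path object of `E`, and this is a weak equivalence as `Y` is
weakly contractible. -/
lemma weakEquivalence_of_isLimit_kernelFork {E Y : C} [IsFibrant Y]
    (hY : IsWeaklyContractible Y) (q : E ⟶ Y) [Fibration q] {F : C} (k : F ⟶ E) (hk : k ≫ q = 0)
    (hlim : IsLimit (KernelFork.ofι k hk)) : WeakEquivalence k := by
  have : IsFibrant E := isFibrant_of_fibration q
  obtain ⟨Q, _⟩ := PathObject.exists_very_good E
  have : Mono k := mono_of_isLimit_fork hlim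
  let ev : Q.P ⟶ Y ⨯ E := Q.p ≫ prod.map q (𝟙 E)
  have hev : ev = prod.lift (Q.p₀ ≫ q) Q.p₁ := by
    ext <;> simp [ev]
  have := weakEquivalence_prod_snd Y E hY
  have : WeakEquivalence ev := by
    have : ev ≫ prod.snd = Q.p₁ := by simp [hev]
    exact weakEquivalence_of_postcomp_of_fac this
  have hF (s : PullbackCone (prod.lift (0 : E ⟶ Y) (𝟙 E)) ev) : ∃ l, l ≫ k = s.snd ≫ Q.p₀ := by
    have := s.condition =≫ prod.fst
    exact ⟨_, (KernelFork.IsLimit.lift' hlim _ (by simpa [hev] using this.symm)).2⟩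
  choose l hl using hF
  have sq : IsPullback (pullback.snd k Q.p₀ ≫ Q.p₁) (pullback.snd k Q.p₀)
      (prod.lift (0 : E ⟶ Y) (𝟙 E)) ev := by
    refine ⟨⟨?_⟩, ⟨PullbackCone.IsLimit.mk _ (fun s ↦ pullback.lift (l s) s.snd (hl s))
      ?_ ?_ ?_⟩⟩
    · rw [hev]
      ext
      · simp [← pullback.condition_assoc, hk]
      · simp
    · intro s
      have := s.condition =≫ prod.snd
      simpa [hev] using this.symm
    · intro s; simp
    · intro s m _ hm
      ext
      · rw [← cancel_mono k]
        rw [Category.assoc, pullback.condition, reassoc_of% hm, pullback.lift_fst, hl]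
      · simpa using hm
  have := weakEquivalence_of_isPullback sq
  let σ : F ⟶ pullback k Q.p₀ := pullback.lift (𝟙 F) (k ≫ Q.ι) (by simp)
  have : WeakEquivalence σ :=
    weakEquivalence_of_postcomp_of_fac (pullback.lift_fst (𝟙 F) (k ≫ Q.ι) (by simp))
  have : σ ≫ pullback.snd k Q.p₀ ≫ Q.p₁ = k := by simp [σ]
  rw [← this]
  infer_instance

/-- A base change does not change the fibre. -/
lemma isIso_kernel_of_isPullback {X X' Y Y' : C} {f : X' ⟶ X} {p' : X' ⟶ Y'} {p : X ⟶ Y}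
    {g : Y' ⟶ Y} (sq : IsPullback f p' p g) (k : kernel p' ⟶ kernel p)
    (hk : k ≫ kernel.ι p = kernel.ι p' ≫ f) : IsIso k := by
  let l : kernel p ⟶ kernel p' :=
    kernel.lift _ (sq.lift (kernel.ι p) 0 (by simp)) (by simp)
  refine ⟨l, ?_, ?_⟩
  · rw [← cancel_mono (kernel.ι p')]
    apply sq.hom_ext <;> simp [l, hk]
  · rw [← cancel_mono (kernel.ι p)]
    simp [l, hk]

/-- The fibre of a fibration is fibrant. -/
instance isFibrant_kernel {X Y : C} (p : X ⟶ Y) [Fibration p] [HasZeroObject C] :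
    IsFibrant (kernel p) := by
  open ZeroObject in
  have sq : IsPullback (0 : kernel p ⟶ (0 : C)) (kernel.ι p) 0 p :=
    ⟨⟨by simp⟩, ⟨PullbackCone.IsLimit.mk _ (fun s ↦ kernel.lift _ s.snd (by
      rw [← s.condition]; simp)) (fun s ↦ Subsingleton.elim _ _) (by simp) (by
      intro s m _ hm
      rw [← cancel_mono (kernel.ι p)]
      simpa using hm)⟩⟩
  exact (isFibrant_iff_of_isTerminal _ HasZeroObject.zeroIsTerminal).2 (fibration_of_isPullback sq)

/-! ### Transport of obstruction theories -/

@[simp]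
lemma fibreMap_ι {p p' : Arrow C} (φ : p ⟶ p') :
    fibreMap φ ≫ kernel.ι p'.hom = kernel.ι p.hom ≫ φ.left :=
  kernel.lift_ι _ _ _

lemma fibreMap_comp {p p' p'' : Arrow C} (φ : p ⟶ p') (ψ : p' ⟶ p'') :
    fibreMap (φ ≫ ψ) = fibreMap φ ≫ fibreMap ψ := by
  rw [← cancel_mono (kernel.ι p''.hom)]
  simp only [fibreMap_ι, Category.assoc, Arrow.comp_left]
  rw [← Category.assoc, ← Category.assoc, fibreMap_ι]

/-- If a square `φ : i ⟶ i'` is such that a square `i' ⟶ p` has a lift as soon as the composite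
with `φ` does, then obstructions for `i` are also obstructions for `i'`. -/
def ObstructionTheory.ofLift {A B A' B' : C} {i : A ⟶ B} {i' : A' ⟶ B'} {P : MorphismProperty C}
    (T : ObstructionTheory i P) (φ : Arrow.mk i ⟶ Arrow.mk i')
    (h : ∀ ⦃p : Arrow C⦄, P p.hom → ∀ (s : Arrow.mk i' ⟶ p) (l : B ⟶ p.left),
      i ≫ l = φ.left ≫ s.left → l ≫ p.hom = φ.right ≫ s.right →
      ∃ l' : B' ⟶ p.left, i' ≫ l' = s.left ∧ l' ≫ p.hom = s.right) :
    ObstructionTheory i' P where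
  W := T.W
  obstruction p hp s := T.obstruction hp (φ ≫ s)
  lift_iff p hp s := by
    rw [← T.lift_iff]
    constructor
    · rintro ⟨l, h₁, h₂⟩
      refine ⟨φ.right ≫ l, ?_, ?_⟩
      · have hw : φ.left ≫ i' = i ≫ φ.right := φ.w
        simp [← h₁, reassoc_of% hw]
      · simp [h₂]
    · rintro ⟨l, h₁, h₂⟩
      exact h hp s l h₁ h₂
  functorial p p' hp hp' s ψ := by
    rw [← T.functorial hp hp', Category.assoc]

lemma HasFibrantObstructionTheory.of_retract {A B A' B' : C} {i : A ⟶ B} {i' : A' ⟶ B'}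
    (hi : HasFibrantObstructionTheory i) (r : RetractArrow i' i) :
    HasFibrantObstructionTheory i' := by
  obtain ⟨T⟩ := hi
  refine ⟨T.ofLift r.r fun p hp s l h₁ h₂ ↦ ⟨r.i.right ≫ l, ?_, ?_⟩⟩
  · have hw : r.i.left ≫ i = i' ≫ r.i.right := r.i.w
    have hr : r.i.left ≫ r.r.left = 𝟙 _ := congr_arg CommaMorphism.left r.retract
    rw [← reassoc_of% hw, h₁, reassoc_of% hr]
  · have hr : r.i.right ≫ r.r.right = 𝟙 _ := congr_arg CommaMorphism.right r.retract
    rw [Category.assoc, h₂, reassoc_of% hr]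

lemma HasFibrantObstructionTheory.of_isPushout {A B A' B' : C} {f : A ⟶ A'} {i : A ⟶ B}
    {i' : A' ⟶ B'} {g : B ⟶ B'} (sq : IsPushout f i i' g) (hi : HasFibrantObstructionTheory i) :
    HasFibrantObstructionTheory i' := by
  obtain ⟨T⟩ := hi
  refine ⟨T.ofLift (Arrow.homMk f g sq.w) fun p hp s l h₁ h₂ ↦
    ⟨sq.desc s.left l (by simpa using h₁.symm), by simp, ?_⟩⟩
  apply sq.hom_ext
  · simp
  · simpa using h₂

/-- A lift in the composite square `i ⟶ i' ⟶ p` glues to a map from the source of the corner map,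
and this extends along the corner map. -/
lemma HasFibrantObstructionTheory.of_isProjectiveTrivialCofibration {A B A' B' : C} {i : A ⟶ B}
    {i' : A' ⟶ B'} (hi : HasFibrantObstructionTheory i) (φ : Arrow.mk i ⟶ Arrow.mk i')
    (hφ : IsProjectiveTrivialCofibration φ) : HasFibrantObstructionTheory i' := by
  obtain ⟨T⟩ := hi
  obtain ⟨_, _, _, _⟩ := hφ
  refine ⟨T.ofLift φ fun p hp s l h₁ h₂ ↦ ?_⟩
  have := hp.1
  have sq : CommSq (pushout.desc l s.left h₁) (cornerMap φ) p.hom s.right := by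
    refine ⟨?_⟩
    apply pushout.hom_ext
    · rw [pushout.inl_desc_assoc]
      exact h₂.trans (inl_cornerMap_assoc φ _).symm
    · rw [pushout.inr_desc_assoc]
      exact s.w.trans (inr_cornerMap_assoc φ _).symm
  refine ⟨sq.lift, ?_, sq.fac_right⟩
  change (Arrow.mk i').hom ≫ _ = _
  rw [← inr_cornerMap φ, Category.assoc, sq.fac_left, pushout.inr_desc]

/-- A path object of a fibration `p` with fibrant target in the category of arrows: the
diagonal of `p` factors as `c` followed by the levelwise fibration `π`, and `c` is a weak
equivalence on fibres. -/
lemma exists_pathObject_arrow {X Y : C} (p : X ⟶ Y) (hp : fibrationsWithFibrantTarget C p) :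
    ∃ (X' Y' : C) (p' : X' ⟶ Y') (π : Arrow.mk p' ⟶ Arrow.mk (prod.map p p))
      (c : Arrow.mk p ⟶ Arrow.mk p'), fibrationsWithFibrantTarget C p' ∧
      Fibration π.left ∧ Fibration π.right ∧
      c ≫ π = Arrow.homMk (diag X) (diag Y) (by simp) ∧ WeakEquivalence (fibreMap c) := by
  obtain ⟨_, _⟩ := hp
  obtain ⟨Q, _⟩ := PathObject.exists_very_good Y
  obtain ⟨Z, j, r, _, _, _, fac⟩ := exists_trivialCofibration_fibration
    (pullback.lift (diag X) (p ≫ Q.ι) (by ext <;> simp) : X ⟶ pullback (prod.map p p) Q.p)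
  have hj₁ : j ≫ r ≫ pullback.fst _ _ = diag X := by simp [reassoc_of% fac]
  have hj₂ : j ≫ r ≫ pullback.snd _ _ = p ≫ Q.ι := by simp [reassoc_of% fac]
  let p' : Z ⟶ Q.P := r ≫ pullback.snd _ _
  let c : Arrow.mk p ⟶ Arrow.mk p' := Arrow.homMk j Q.ι hj₂
  refine ⟨Z, Q.P, p', Arrow.homMk (r ≫ pullback.fst _ _) Q.p (by simp [p', pullback.condition]),
    c, ⟨inferInstance, inferInstance⟩, ?_, ?_, ?_, ?_⟩
  · exact inferInstanceAs (Fibration (r ≫ pullback.fst _ _))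
  · exact inferInstanceAs (Fibration Q.p)
  · apply Arrow.hom_ext
    · exact hj₁
    · change Q.ι ≫ Q.p = _
      ext <;> simp
  -- compare with the base change of `p` along the trivial fibration `Q.p₀`
  let w : Z ⟶ pullback p Q.p₀ := pullback.lift (r ≫ pullback.fst _ _ ≫ prod.fst) p' (by
    have := pullback.condition (f := prod.map p p) (g := Q.p) =≫ prod.fst
    simp only [Category.assoc, prod.map_fst, Q.p_fst] at this
    simp [p', this])
  have : WeakEquivalence w := by
    have h₁ : j ≫ (w ≫ pullback.fst p Q.p₀) = 𝟙 X := by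
      simp [w, reassoc_of% hj₁]
    have : WeakEquivalence (w ≫ pullback.fst p Q.p₀) := weakEquivalence_of_precomp_of_fac h₁
    exact weakEquivalence_of_postcomp w (pullback.fst p Q.p₀)
  let k : kernel p' ⟶ kernel (pullback.snd p Q.p₀) :=
    kernel.lift _ (kernel.ι _ ≫ w) (by simp [w])
  have : WeakEquivalence k := weakEquivalence_kernel_of_fac p' (pullback.snd p Q.p₀) w
    (by simp [w]) k (by simp [k])
  let e : kernel (pullback.snd p Q.p₀) ⟶ kernel p :=
    kernel.lift _ (kernel.ι _ ≫ pullback.fst _ _) (by simp [pullback.condition])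
  have : IsIso e := isIso_kernel_of_isPullback (IsPullback.of_hasPullback p Q.p₀) e (by simp [e])
  have h : fibreMap c ≫ (k ≫ e) = 𝟙 _ := by
    have hc : fibreMap c ≫ kernel.ι p' = kernel.ι p ≫ j := fibreMap_ι c
    rw [← cancel_mono (kernel.ι p)]
    simp [k, e, w, reassoc_of% hc, reassoc_of% hj₁]
  exact weakEquivalence_of_postcomp_of_fac h

/-- The obstruction of a square `i' ⟶ p` only depends on its restriction along a projective
trivial cofibration into `i'`: two squares with the same restriction are homotopic, so that they
are the two projections of one square to a path object of `p`. -/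
lemma ObstructionTheory.obstruction_eq {A' B' : C} {f : Arrow C} {i' : A' ⟶ B'}
    (T : ObstructionTheory i' (fibrationsWithFibrantTarget C)) {φ : f ⟶ Arrow.mk i'}
    (hφ : IsProjectiveTrivialCofibration φ) {p : Arrow C}
    (hp : fibrationsWithFibrantTarget C p.hom) (t₁ t₂ : Arrow.mk i' ⟶ p)
    (h : φ ≫ t₁ = φ ≫ t₂) : T.obstruction hp t₁ = T.obstruction hp t₂ := by
  obtain ⟨X, Y, p, rfl⟩ := p.mk_surjective
  obtain ⟨X', Y', p', π, c, hp', _, _, hc, _⟩ := exists_pathObject_arrow p hp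
  let pr₁ : Arrow.mk (prod.map p p) ⟶ Arrow.mk p := Arrow.homMk prod.fst prod.fst (by simp)
  let pr₂ : Arrow.mk (prod.map p p) ⟶ Arrow.mk p := Arrow.homMk prod.snd prod.snd (by simp)
  have h₁ : φ.left ≫ t₁.left = φ.left ≫ t₂.left := congr_arg CommaMorphism.left h
  have h₂ : φ.right ≫ t₁.right = φ.right ≫ t₂.right := congr_arg CommaMorphism.right h
  have w₁ : t₁.left ≫ p = i' ≫ t₁.right := t₁.w
  have w₂ : t₂.left ≫ p = i' ≫ t₂.right := t₂.w
  let t : Arrow.mk i' ⟶ Arrow.mk (prod.map p p) :=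
    Arrow.homMk (prod.lift t₁.left t₂.left) (prod.lift t₁.right t₂.right) (by
      change _ ≫ prod.map p p = i' ≫ _
      ext <;> simp [w₁, w₂])
  obtain ⟨l, -, hl⟩ := hφ.exists_lift π (φ ≫ t₁ ≫ c) t (by
    rw [Category.assoc, Category.assoc, hc]
    apply Arrow.hom_ext
    · change φ.left ≫ t₁.left ≫ diag X = φ.left ≫ prod.lift t₁.left t₂.left
      ext <;> simp [h₁]
    · change φ.right ≫ t₁.right ≫ diag Y = φ.right ≫ prod.lift t₁.right t₂.right
      ext <;> simp [h₂])
  have ht₁ : l ≫ π ≫ pr₁ = t₁ := by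
    rw [reassoc_of% hl]
    apply Arrow.hom_ext
    · exact prod.lift_fst _ _
    · exact prod.lift_fst _ _
  have ht₂ : l ≫ π ≫ pr₂ = t₂ := by
    rw [reassoc_of% hl]
    apply Arrow.hom_ext
    · exact prod.lift_snd _ _
    · exact prod.lift_snd _ _
  have e₁ : c ≫ π ≫ pr₁ = 𝟙 _ := by
    rw [reassoc_of% hc]
    apply Arrow.hom_ext
    · exact prod.lift_fst _ _
    · exact prod.lift_fst _ _
  have e₂ : c ≫ π ≫ pr₂ = 𝟙 _ := by
    rw [reassoc_of% hc]
    apply Arrow.hom_ext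
    · exact prod.lift_snd _ _
    · exact prod.lift_snd _ _
  -- the two projections agree in the homotopy category since they have the common section `c`
  rw [← ht₁, ← ht₂, T.functorial hp' hp, T.functorial hp' hp]
  congr 1
  rw [← cancel_epi ((toHo C).map (fibreMap c)), ← Functor.map_comp, ← Functor.map_comp,
    ← fibreMap_comp, ← fibreMap_comp, e₁, e₂]

/-- The obstruction of a square `i ⟶ p` is that of any extension `i' ⟶ p`. -/
lemma HasFibrantObstructionTheory.of_isProjectiveTrivialCofibration' {A B A' B' : C} {i : A ⟶ B}
    {i' : A' ⟶ B'} (hi' : HasFibrantObstructionTheory i') (φ : Arrow.mk i ⟶ Arrow.mk i')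
    (hφ : IsProjectiveTrivialCofibration φ) : HasFibrantObstructionTheory i := by
  obtain ⟨T⟩ := hi'
  have ext {p : Arrow C} (hp : fibrationsWithFibrantTarget C p.hom) (s : Arrow.mk i ⟶ p) :=
    hφ.exists_extension hp s
  refine ⟨⟨T.W, fun p hp s ↦ T.obstruction hp (ext hp s).choose, fun p hp s ↦ ?_,
    fun p p' hp hp' s ψ ↦ ?_⟩⟩
  · constructor
    · rintro ⟨l, h₁, h₂⟩
      have := hp.1
      have := hp.2
      have : IsFibrant p.left := isFibrant_of_fibration p.hom
      -- the square `s` factors through the identity of `p.left`, so it has an extension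
      -- which admits a lift
      obtain ⟨t, ht⟩ := ext (p := Arrow.mk (𝟙 p.left))
        ⟨inferInstanceAs (Fibration (𝟙 p.left)), this⟩
        (Arrow.homMk s.left l (by simpa using h₁.symm))
      have ht₁ : φ.left ≫ t.left = s.left := congr_arg CommaMorphism.left ht
      have ht₂ : φ.right ≫ t.right = l := congr_arg CommaMorphism.right ht
      have w : t.left ≫ 𝟙 p.left = i' ≫ t.right := t.w
      let ε : Arrow.mk (𝟙 p.left) ⟶ p := Arrow.homMk (𝟙 _) p.hom (by simp)
      rw [T.obstruction_eq hφ hp _ (t ≫ ε)]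
      · exact (T.lift_iff _ _).1
          ⟨t.right, by simpa [ε] using w.symm, by simp [ε]⟩
      · rw [(ext hp s).choose_spec, reassoc_of% ht]
        apply Arrow.hom_ext
        · simp [ε]
        · simp [ε, h₂]
    · intro h
      obtain ⟨l, h₁, h₂⟩ := (T.lift_iff _ _).2 h
      have hs := (ext hp s).choose_spec
      have hs₁ : φ.left ≫ (ext hp s).choose.left = s.left := congr_arg CommaMorphism.left hs
      have hs₂ : φ.right ≫ (ext hp s).choose.right = s.right := congr_arg CommaMorphism.right hs
      have w : φ.left ≫ i' = i ≫ φ.right := φ.w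
      exact ⟨φ.right ≫ l, by rw [← reassoc_of% w, h₁, hs₁], by rw [Category.assoc, h₂, hs₂]⟩
  · rw [← T.functorial hp hp']
    apply T.obstruction_eq hφ
    rw [(ext hp' (s ≫ ψ)).choose_spec, reassoc_of% (ext hp s).choose_spec]

lemma HasFibrantObstructionTheory.of_isLevelwiseWeakEquivalence {A B A' B' : C} {i : A ⟶ B}
    {i' : A' ⟶ B'} (hT : HasFibrantObstructionTheory i) (φ : Arrow.mk i ⟶ Arrow.mk i')
    (hφ : IsLevelwiseWeakEquivalence φ) (hi : cofibrationsWithCofibrantSource C i)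
    (hi' : cofibrationsWithCofibrantSource C i') : HasFibrantObstructionTheory i' := by
  obtain ⟨A'', B'', j, φ₁, φ₂, σ, h₁, h₂, -, -⟩ :=
    exists_isProjectiveTrivialCofibration φ hφ hi hi'
  exact (hT.of_isProjectiveTrivialCofibration φ₁ h₁).of_retract ⟨σ, φ₂, h₂⟩

lemma hasFibrantObstructionTheory_iff_of_isLevelwiseWeakEquivalence {A B A' B' : C} {i : A ⟶ B}
    {i' : A' ⟶ B'} (φ : Arrow.mk i ⟶ Arrow.mk i')
    (hφ : IsLevelwiseWeakEquivalence φ) (hi : cofibrationsWithCofibrantSource C i)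
    (hi' : cofibrationsWithCofibrantSource C i') :
    HasFibrantObstructionTheory i ↔ HasFibrantObstructionTheory i' := by
  refine ⟨fun h ↦ h.of_isLevelwiseWeakEquivalence φ hφ hi hi', fun h ↦ ?_⟩
  obtain ⟨A'', B'', j, φ₁, φ₂, σ, h₁, -, hj, hσ⟩ :=
    exists_isProjectiveTrivialCofibration φ hφ hi hi'
  exact (h.of_isLevelwiseWeakEquivalence σ hσ hi' hj).of_isProjectiveTrivialCofibration' φ₁ h₁

lemma HasFibrantObstructionTheory.of_weaklyEquivalent
    [MorphismProperty.HasFunctorialFactorization (cofibrations C) (trivialFibrations C)]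
    {A B A' B' : C} {i : A ⟶ B} {i' : A' ⟶ B'}
    (hT : HasFibrantObstructionTheory i) (h : WeaklyEquivalent (Arrow.mk i) (Arrow.mk i'))
    (hi : cofibrationsWithCofibrantSource C i) (hi' : cofibrationsWithCofibrantSource C i') :
    HasFibrantObstructionTheory i' := by
  obtain ⟨R, hR, hε, hφ⟩ := exists_cofibrantReplacement_arrow C
  have key {f g : Arrow C} (h : WeaklyEquivalent f g) :
      HasFibrantObstructionTheory (R f).hom ↔ HasFibrantObstructionTheory (R g).hom := by
    induction h with
    | rel f g h =>
      obtain ⟨φ, h⟩ := h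
      obtain ⟨ψ, hψ⟩ := hφ φ h
      exact hasFibrantObstructionTheory_iff_of_isLevelwiseWeakEquivalence ψ hψ (hR f) (hR g)
    | refl f => rfl
    | symm f g _ h => exact h.symm
    | trans f g k _ _ h h' => exact h.trans h'
  obtain ⟨ε, h₁⟩ := hε (Arrow.mk i)
  obtain ⟨ε', h₂⟩ := hε (Arrow.mk i')
  rw [← hasFibrantObstructionTheory_iff_of_isLevelwiseWeakEquivalence ε' h₂ (hR _) hi', ← key h,
    hasFibrantObstructionTheory_iff_of_isLevelwiseWeakEquivalence ε h₁ (hR _) hi]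
  exact hT

/-! ### Cofibrations with weakly contractible target -/

/-- The map from the fibre of `p` to the total space of the base change of `p` along a map `b`. -/
noncomputable def fibreToPullback {B : C} (p : Arrow C) (b : B ⟶ p.right) :
    fibre p ⟶ pullback b p.hom :=
  pullback.lift 0 (kernel.ι p.hom) (by simp)

lemma weakEquivalence_fibreToPullback {B : C} [IsFibrant B]
    (hB : IsWeaklyContractible B) (p : Arrow C) [Fibration p.hom] (b : B ⟶ p.right) :
    WeakEquivalence (fibreToPullback p b) := by
  refine weakEquivalence_of_isLimit_kernelFork hB (pullback.fst b p.hom) _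
    (by simp [fibreToPullback]) (KernelFork.IsLimit.ofι _ _
      (fun t ht ↦ kernel.lift _ (t ≫ pullback.snd _ _) ?_) ?_ ?_)
  · rw [Category.assoc, ← pullback.condition, reassoc_of% ht, zero_comp]
  · intro T t ht
    apply pullback.hom_ext
    · simp [fibreToPullback, ht]
    · simp [fibreToPullback]
  · intro T t ht m hm
    rw [← cancel_mono (kernel.ι p.hom)]
    simp [← hm, fibreToPullback]

lemma fibreToPullback_pullbackMap {B : C} {p p' : Arrow C} (b : B ⟶ p.right) (b' : B ⟶ p'.right)
    (ψ : p ⟶ p') (h : b ≫ ψ.right = b') :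
    fibreToPullback p b ≫ pullbackMap b b' ψ h = fibreMap ψ ≫ fibreToPullback p' b' := by
  apply pullback.hom_ext
  · simp [fibreToPullback, pullbackMap]
  · simp [fibreToPullback, pullbackMap]

/-- A square from `i` to a fibration `p` with fibre `F` amounts to a map from the source of `i` to
the base change `E` of `p`; if the target of `i` is weakly contractible and fibrant, then `F ⟶ E` is
a weak equivalence, and the obstruction is the class `A ⟶ E ⟵ F`. -/
lemma hasFibrantObstructionTheory_of_isFibrant {A B : C} {i : A ⟶ B}
    (hi : cofibrationsWithCofibrantSource C i) (hB : IsWeaklyContractible B) [IsFibrant B] :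
    HasFibrantObstructionTheory i := by
  have hwe {p : Arrow C} (hp : fibrationsWithFibrantTarget C p.hom) (s : Arrow.mk i ⟶ p) :
      IsIso ((toHo C).map (fibreToPullback p s.right)) := by
    have := hp.1
    have := weakEquivalence_fibreToPullback (B := B) hB p s.right
    infer_instance
  obtain ⟨_, _⟩ := hi
  refine ⟨⟨A, fun p hp s ↦ (toHo C).map (sourceToPullback s) ≫
    letI := hwe hp s; inv ((toHo C).map (fibreToPullback p s.right)), fun p hp s ↦ ?_,
    fun p p' hp hp' s ψ ↦ ?_⟩⟩
  · have := hwe hp s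
    have := hp.1
    have : IsFibrant (Arrow.mk i).right := ‹IsFibrant B›
    have : IsFibrant (pullback (X := B) s.right p.hom) :=
      isFibrant_of_fibration (pullback.fst s.right p.hom)
    have htriv : (toHo C).map (sourceToPullback s) ≫
        inv ((toHo C).map (fibreToPullback p s.right)) = trivialClass A (fibre p) ↔
        (toHo C).map (sourceToPullback s) = (toHo C).map 0 := by
      rw [IsIso.comp_inv_eq, trivialClass, ← Functor.map_comp, zero_comp]
    rw [htriv]
    constructor
    · rintro ⟨l, h₁, h₂⟩
      have : sourceToPullback s = i ≫ pullback.lift (𝟙 B) l (by simp [h₂]) := by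
        apply pullback.hom_ext <;> simp [sourceToPullback, h₁]
      rw [this, Functor.map_comp, toHo_map_eq_of_isWeaklyContractible hB i 0, ← Functor.map_comp,
        zero_comp]
    · intro h
      obtain ⟨l, hl⟩ := exists_extension_of_toHo_map_eq i _ _ h 0 (by simp)
      -- correct the extension to one over `B`
      obtain ⟨l', h₁, h₂⟩ := exists_lift_of_exists_extension i (Y := B) hB
        (pullback.fst s.right p.hom) (sourceToPullback s) (𝟙 B)
        (by simp [sourceToPullback]) l hl
      refine ⟨l' ≫ pullback.snd _ _, ?_, ?_⟩
      · rw [reassoc_of% h₁]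
        simp [sourceToPullback]
      · rw [Category.assoc, ← pullback.condition, reassoc_of% h₂]
  · have := hwe hp s
    have := hwe hp' (s ≫ ψ)
    have h := fibreToPullback_pullbackMap (B := B) s.right (s ≫ ψ).right ψ rfl
    rw [IsIso.comp_inv_eq, Category.assoc, Category.assoc, ← Functor.map_comp, ← h,
      Functor.map_comp, IsIso.inv_hom_id_assoc, ← Functor.map_comp, sourceToPullback_pullbackMap]

lemma hasFibrantObstructionTheory_of_isWeaklyContractible {A B : C} {i : A ⟶ B}
    (hi : cofibrationsWithCofibrantSource C i) (hB : IsWeaklyContractible B) :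
    HasFibrantObstructionTheory i := by
  obtain ⟨B', v, q, _, _, _, fac⟩ := exists_trivialCofibration_fibration (terminal.from B)
  have : IsFibrant B' := by
    rwa [isFibrant_iff, Subsingleton.elim (terminal.from B') q]
  have : WeakEquivalence (terminal.from B) := hB
  have hB' : IsWeaklyContractible B' :=
    weakEquivalence_of_precomp_of_fac (Subsingleton.elim (v ≫ terminal.from B') (terminal.from B))
  have := hi.1
  have hi' : cofibrationsWithCofibrantSource C (i ≫ v) := ⟨inferInstance, hi.2⟩
  exact (hasFibrantObstructionTheory_iff_of_isLevelwiseWeakEquivalence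
    (Arrow.homMk (𝟙 A) v (Category.id_comp _))
    ⟨inferInstanceAs (WeakEquivalence (𝟙 A)), ‹_›⟩ hi hi').2
      (hasFibrantObstructionTheory_of_isFibrant hi' hB')

lemma isAdmissibleClass_fibrantObstructionClass
    [MorphismProperty.HasFunctorialFactorization (cofibrations C) (trivialFibrations C)] :
    IsAdmissibleClass (fibrantObstructionClass C) where
  le _ _ _ h := h.1
  contractible _ _ _ hi hB := ⟨hi, hasFibrantObstructionTheory_of_isWeaklyContractible hi hB⟩
  retract A B A' B' i i' r hi := by
    obtain ⟨r⟩ := r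
    refine ⟨⟨⟨MorphismProperty.of_retract r hi.1.1.mem⟩, ?_⟩, hi.2.of_retract r⟩
    refine ⟨MorphismProperty.of_retract (f := initial.to A') (g := initial.to A)
      ⟨Arrow.homMk (𝟙 _) r.i.left (initialIsInitial.hom_ext _ _),
        Arrow.homMk (𝟙 _) r.r.left (initialIsInitial.hom_ext _ _), ?_⟩ hi.1.2.mem⟩
    apply Arrow.hom_ext
    · exact Category.comp_id _
    · exact congr_arg CommaMorphism.left r.retract
  weakEquivalence _ _ _ _ _ _ h hi' hi := ⟨hi', hi.2.of_weaklyEquivalent h hi.1 hi'⟩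
  cobaseChange _ _ _ _ _ _ _ _ sq hA' hi := by
    refine ⟨⟨?_, hA'⟩, hi.2.of_isPushout sq⟩
    exact ⟨MorphismProperty.of_isPushout sq hi.1.1.mem⟩

/-! ### Minimality -/

/-- Apply the obstruction theory to a square `s` from `i : A ⟶ B` to a fibration `p : X ⟶ Y`, where
`A ⟶ X` and `B ⟶ Y` are weak equivalences and `Y` is fibrant. Attach a cone to `X` along a map
`W ⟶ F` representing the obstruction. The obstruction vanishes over the result `D`, so that `i` is
a retract up to weak equivalence of `X ⟶ D`, which is a cobase change of the inclusion of `W` in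
its cone. -/
lemma IsAdmissibleClass.of_hasFibrantObstructionTheory [HasZeroObject C] {K : MorphismProperty C}
    (hK : IsAdmissibleClass K) {A B : C} {i : A ⟶ B} (hi : cofibrationsWithCofibrantSource C i)
    (h : HasFibrantObstructionTheory i) : K i := by
  obtain ⟨T⟩ := h
  obtain ⟨Y, v, q, _, _, _, -⟩ := exists_trivialCofibration_fibration (terminal.from B)
  have : IsFibrant Y := by rwa [isFibrant_iff, Subsingleton.elim (terminal.from Y) q]
  obtain ⟨X, u, p, _, _, _, hup⟩ := exists_trivialCofibration_fibration (i ≫ v)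
  have := hi.2
  have : IsCofibrant X := isCofibrant_of_cofibration u
  let s : Arrow.mk i ⟶ Arrow.mk p := Arrow.homMk u v hup
  have hp : fibrationsWithFibrantTarget C (Arrow.mk p).hom := ⟨‹_›, ‹_›⟩
  -- a representative `a` of the obstruction, defined on a cofibrant replacement of `T.W`
  obtain ⟨W, z, π, _, _, _, -⟩ := exists_cofibration_trivialFibration (initial.to T.W)
  have : IsCofibrant W := by rwa [isCofibrant_iff, Subsingleton.elim (initial.to W) z]
  obtain ⟨a, ha⟩ := map_surjective_of_isLocalization (toHo C) W (kernel p)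
    ((toHo C).map π ≫ T.obstruction hp s)
  -- the cone of `W`
  obtain ⟨CW, c, ρ, _, _, _, -⟩ := exists_cofibration_trivialFibration (terminal.from W)
  have hCW : IsWeaklyContractible CW := by
    rwa [IsWeaklyContractible, Subsingleton.elim (terminal.from CW) ρ]
  let f : W ⟶ X := a ≫ kernel.ι p
  let g : X ⟶ pushout f c := pushout.inl f c
  have hg : K g := hK.cobaseChange f c g (pushout.inr f c) (IsPushout.of_hasPushout f c) ‹_›
    (hK.contractible c ⟨‹_›, ‹_›⟩ hCW)
  obtain ⟨D, d, p', _, _, _, hdp⟩ := exists_trivialCofibration_fibration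
    (pushout.desc p 0 (by simp [f]) : pushout f c ⟶ Y)
  have hgd : K (g ≫ d) :=
    hK.of_hom (𝟙 X) d (by simp) ⟨inferInstance, inferInstance⟩ hg
  have hp' : fibrationsWithFibrantTarget C (Arrow.mk p').hom := ⟨‹_›, ‹_›⟩
  let φ : Arrow.mk p ⟶ Arrow.mk p' := Arrow.homMk (g ≫ d) (𝟙 Y) (by simp [hdp, g])
  -- the map `W ⟶ F ⟶ F'` to the fibre of `p'` factors through the cone
  have hφ : T.obstruction hp' (s ≫ φ) = trivialClass _ _ := by
    have hc : a ≫ fibreMap φ =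
        c ≫ kernel.lift p' (pushout.inr f c ≫ d) (by simp [hdp]) := by
      have hφ : fibreMap φ ≫ kernel.ι p' = kernel.ι p ≫ g ≫ d := fibreMap_ι φ
      rw [← cancel_mono (kernel.ι p'), Category.assoc, hφ, Category.assoc, kernel.lift_ι,
        ← pushout.condition_assoc]
      simp [f, g]
    rw [T.functorial hp hp', trivialClass, ← cancel_epi ((toHo C).map π), ← reassoc_of% ha,
      ← Functor.map_comp, ← Functor.map_comp, hc, Functor.map_comp,
      toHo_map_eq_of_isWeaklyContractible hCW c 0, ← Functor.map_comp, zero_comp, comp_zero]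
  obtain ⟨l, h₁, h₂⟩ := (T.lift_iff hp' (s ≫ φ)).2 hφ
  have h₃ : l ≫ p' = v := h₂.trans (Category.comp_id v)
  have : WeakEquivalence (l ≫ p') := by rwa [h₃]
  exact hK.of_weak_retract hi hgd u l p' h₁

/-! ### Obstruction theories with respect to all fibrations -/

lemma IsRightProper.weakEquivalence_fibreMap (hC : IsRightProper C) {p p' : Arrow C}
    [Fibration p.hom] [Fibration p'.hom] (φ : p ⟶ p') (hφ : IsLevelwiseWeakEquivalence φ) :
    WeakEquivalence (fibreMap φ) := by
  obtain ⟨_, _⟩ := hφ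
  let w := pullback.lift φ.left p.hom φ.w
  have hw : w ≫ pullback.snd _ _ = p.hom := pullback.lift_snd _ _ _
  have : WeakEquivalence w :=
    hC.weakEquivalence_pullback_lift φ.left p.hom p'.hom φ.right φ.w
  let k : kernel p.hom ⟶ kernel (pullback.snd p'.hom φ.right) :=
    kernel.lift _ (kernel.ι _ ≫ w) (by simp [hw])
  let e : kernel (pullback.snd p'.hom φ.right) ⟶ kernel p'.hom :=
    kernel.lift _ (kernel.ι _ ≫ pullback.fst _ _) (by simp [pullback.condition])
  have : WeakEquivalence k := weakEquivalence_kernel_of_fac p.hom _ w hw k (by simp [k])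
  have : IsIso e := isIso_kernel_of_isPullback (IsPullback.of_hasPullback _ _) e (by simp [e])
  have h : fibreMap φ = k ≫ e := by
    rw [← cancel_mono (kernel.ι p'.hom)]
    simp [k, e, w]
  rw [h]
  infer_instance

lemma HasFibrantObstructionTheory.hasObstructionTheory
    [MorphismProperty.HasFunctorialFactorization (trivialCofibrations C) (fibrations C)]
    (hC : IsRightProper C) {A B : C} {i : A ⟶ B} [Cofibration i]
    (h : HasFibrantObstructionTheory i) : HasObstructionTheory i := by
  obtain ⟨T⟩ := h
  obtain ⟨R, η, hR, hη, hRη⟩ := exists_fibrantReplacement_arrow C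
  have hF {p : Arrow C} (hp : fibrations C p.hom) : IsIso ((toHo C).map (fibreMap (η p))) := by
    rw [← fibration_iff] at hp
    have := (hR p).1
    have := hC.weakEquivalence_fibreMap (η p) (hη p)
    infer_instance
  refine ⟨⟨T.W, fun p hp s ↦ T.obstruction (hR p) (s ≫ η p) ≫
    letI := hF hp; inv ((toHo C).map (fibreMap (η p))), fun p hp s ↦ ?_,
    fun p p' hp hp' s φ ↦ ?_⟩⟩
  · have := hF hp
    rw [← fibration_iff] at hp
    have := (hR p).1
    rw [IsIso.comp_inv_eq, trivialClass, ← Functor.map_comp, zero_comp]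
    refine Iff.trans ?_ (T.lift_iff (hR p) (s ≫ η p))
    constructor
    · rintro ⟨l, h₁, h₂⟩
      exact ⟨l ≫ (η p).left, by simp [reassoc_of% h₁], by simp [reassoc_of% h₂]⟩
    · rintro ⟨l, h₁, h₂⟩
      exact hC.exists_lift (η p) (hη p) s l h₁ h₂
  · have := hF hp
    have := hF hp'
    obtain ⟨ψ, hψ⟩ := hRη φ
    have h : (s ≫ φ) ≫ η p' = (s ≫ η p) ≫ ψ := by
      rw [Category.assoc, Category.assoc, hψ]
    rw [IsIso.comp_inv_eq, h, T.functorial (hR p) (hR p'), Category.assoc, Category.assoc,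
      ← Functor.map_comp, ← fibreMap_comp, ← hψ, fibreMap_comp, Functor.map_comp,
      IsIso.inv_hom_id_assoc]

lemma HasObstructionTheory.hasFibrantObstructionTheory {A B : C} {i : A ⟶ B}
    (h : HasObstructionTheory i) : HasFibrantObstructionTheory i := by
  obtain ⟨T⟩ := h
  exact ⟨⟨T.W, fun p hp s ↦ T.obstruction hp.1.mem s, fun p hp s ↦ T.lift_iff hp.1.mem s,
    fun p p' hp hp' s φ ↦ T.functorial hp.1.mem hp'.1.mem s φ⟩⟩

end ModelObstruction

theorem theorem7p1 (C : Type u) [Category.{v} C] [ModelCategory C]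
    [HasZeroObject C] [HasZeroMorphisms C]
    [MorphismProperty.HasFunctorialFactorization (cofibrations C) (trivialFibrations C)]
    [MorphismProperty.HasFunctorialFactorization (trivialCofibrations C) (fibrations C)] :
    ∃ K : MorphismProperty C,
      IsLeast {K' : MorphismProperty C | ModelObstruction.IsAdmissibleClass K'} K ∧
      K = ModelObstruction.fibrantObstructionClass C ∧
      (ModelObstruction.IsRightProper C → K = ModelObstruction.obstructionClass C) := by
  refine ⟨ModelObstruction.fibrantObstructionClass C,
    ⟨ModelObstruction.isAdmissibleClass_fibrantObstructionClass,
      fun K hK A B i hi ↦ hK.of_hasFibrantObstructionTheory hi.1 hi.2⟩, rfl, fun hC ↦ ?_⟩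
  ext A B i
  refine ⟨fun hi ↦ ⟨hi.1, ?_⟩, fun hi ↦ ⟨hi.1, hi.2.hasFibrantObstructionTheory⟩⟩
  have := hi.1.1
  exact hi.2.hasObstructionTheory hC
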